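/- Let $k\ge 3$ be an integer and $[2k-1]=\{1,\dots,2k-1\}$. The odd graph $O_k$ has as vertices the $(k-1)$-element subsets of $[2k-1]$, two of them being adjacent when they are disjoint. Let $2O_k$ be its bipartite double graph: its vertices are the pairs $(v,i)$ with $v$ a vertex of $O_k$ and $i\in\{0,1\}$, and $(v,i)$, $(w,j)$ are adjacent if and only if $v\cap w=\emptyset$ and $i\ne j$. Let $F(2O_k)$ be the graph on the same vertex set whose edges are those of $2O_k$ together with all pairs $\{(v,i),(v,i^c)\}$, where $0^c=1$ and $1^c=0$. Then, as groups of permutations of the common vertex set, $$\mathrm{Aut}(F(2O_k))=\mathrm{Aut}(2O_k),$$ and this group is isomorphic to $\mathbb{Z}_2\times\mathrm{Sym}(2k-1)$. More precisely, there is an isomorphism of $\mathbb{Z}_2\times\mathrm{Sym}(2k-1)$ onto it that maps the generator of $\mathbb{Z}_2$ to the swap $\theta:(v,i)\mapsto(v,i^c)$ and every $\sigma\in\mathrm{Sym}(2k-1)$ to the permutation $f_\sigma:(v,i)\mapsto(\sigma(v),i)$, where $\sigma(v)=\{\sigma(x): x\in v\}$. -/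

import Mathlib

/-- The automorphism group of a simple graph, as a group of permutations of its vertex set. -/
def graphAut {V : Type*} (G : SimpleGraph V) : Subgroup (Equiv.Perm V) where
  carrier := {f | ∀ u v, G.Adj (f u) (f v) ↔ G.Adj u v}
  one_mem' := fun _ _ => Iff.rfl
  mul_mem' := fun {f g} hf hg u v => (hf (g u) (g v)).trans (hg u v)
  inv_mem' := fun {f} hf u v => by
    simpa using (hf (f⁻¹ u) (f⁻¹ v)).symm

/-- The vertices of the odd graph `O_k`: the `(k-1)`-subsets of a set of `2k-1` elements. -/
abbrev OddVertex (k : ℕ) : Type :=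
  {v : Finset (Fin (2 * k - 1)) // v.card = k - 1}

/-- The odd graph `O_k`: two vertices are adjacent when the subsets are disjoint
(the clause `u ≠ v` is automatic for `2 ≤ k`). -/
def oddGraph (k : ℕ) : SimpleGraph (OddVertex k) where
  Adj u v := u ≠ v ∧ Disjoint u.1 v.1
  symm := ⟨fun _ _ h => ⟨h.1.symm, h.2.symm⟩⟩
  loopless := ⟨fun _ h => h.1 rfl⟩

/-- The bipartite double graph on pairs `(v, i)` with `i` in the two-element set `Bool`:
`(v, i)` and `(w, j)` are adjacent when `v` and `w` are adjacent and `i ≠ j`. -/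
def bipartiteDouble {V : Type*} (G : SimpleGraph V) : SimpleGraph (V × Bool) where
  Adj x y := G.Adj x.1 y.1 ∧ x.2 ≠ y.2
  symm := ⟨fun _ _ h => ⟨h.1.symm, h.2.symm⟩⟩
  loopless := ⟨fun _ h => h.2 rfl⟩

/-- The bipartite double graph on pairs is Mathlib's bipartite double cover. -/
def bipartiteDoubleIso {V : Type*} (G : SimpleGraph V) :
    bipartiteDouble G ≃g G.bipartiteDoubleCover where
  toEquiv := (Equiv.prodComm V Bool).trans (Equiv.boolProdEquivSum V)
  map_rel_iff' := by
    rintro ⟨v, _ | _⟩ ⟨w, _ | _⟩ <;> simp [bipartiteDouble]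

/-- The graph `2O_k`, the bipartite double graph of the odd graph. -/
def doubleOdd (k : ℕ) : SimpleGraph (OddVertex k × Bool) :=
  bipartiteDouble (oddGraph k)

/-- The swap `(v, i) ↦ (v, iᶜ)`. -/
def layerSwap (k : ℕ) : Equiv.Perm (OddVertex k × Bool) where
  toFun x := (x.1, !x.2)
  invFun x := (x.1, !x.2)
  left_inv := fun x => by simp
  right_inv := fun x => by simp

/-- The folded graph `F(2O_k)`: the graph `2O_k` with the additional edges
`{(v, i), (v, iᶜ)}`. -/
def foldedDoubleOdd (k : ℕ) : SimpleGraph (OddVertex k × Bool) where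
  Adj x y := (doubleOdd k).Adj x y ∨ (x.1 = y.1 ∧ y.2 = !x.2)
  symm := ⟨fun x y h => by
    rcases h with h | ⟨h₁, h₂⟩
    · exact Or.inl h.symm
    · exact Or.inr ⟨h₁.symm, by rw [h₂, Bool.not_not]⟩⟩
  loopless := ⟨fun x h => by
    rcases h with h | ⟨_, h⟩
    · exact (doubleOdd k).irrefl h
    · exact Bool.self_ne_not _ h⟩

/-- The map `({x₁, …, x_{k-1}}, i) ↦ ({σ x₁, …, σ x_{k-1}}, i)` induced by a permutation `σ`
of the ground set. -/
def pointPerm (k : ℕ) (σ : Equiv.Perm (Fin (2 * k - 1))) :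
    Equiv.Perm (OddVertex k × Bool) where
  toFun x := (⟨x.1.1.map σ.toEmbedding, by rw [Finset.card_map]; exact x.1.2⟩, x.2)
  invFun x := (⟨x.1.1.map σ.symm.toEmbedding, by rw [Finset.card_map]; exact x.1.2⟩, x.2)
  left_inv := fun x => by ext <;> simp
  right_inv := fun x => by ext <;> simp

/-! A vertex `v` of `O_k` and a point `p ∉ v` determine exactly one neighbour of `v` missing `p`,
the complement of `v ∪ {p}`. Hence `O_k` has no four-cycles, and by counting no triangles once `k ≥
3`.

So in `F(2O_k)` an edge of `2O_k` lies on a single four-cycle, the one through its mirror image,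
while an added edge lies on one for every neighbour of its underlying vertex. This distinguishes the
two kinds of edges (`doubleOdd_adj_iff_not_inTwoSquares`), so automorphisms of the folded graph
preserve `2O_k`.

Conversely, let `f` be an automorphism of `2O_k`; up to the swap it keeps the layer of some vertex.
The neighbours of the two ends of an edge are labelled by the ground points, and the action of `f`
on the labels is a permutation `σ` whose `pointPerm` agrees with `f` there
(`exists_pointPerm_eq_near`). An automorphism fixing all neighbours of both ends of an edge is
trivial (`eq_one_of_fixes_edge_neighbors`), so `f = pointPerm k σ`. Swaps and point permutations
also preserve the folded graph, which gives the other inclusion. -/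

namespace OddVertex

/-! ### Neighbours in the odd graph -/

variable {k : ℕ}

theorem eq_of_subset {u v : OddVertex k} (h : u.1 ⊆ v.1) : u = v :=
  Subtype.ext (Finset.eq_of_subset_of_card_le h (by rw [u.2, v.2]))

theorem card_compl (v : OddVertex k) (hk : 1 ≤ k) : (v.1ᶜ).card = k := by
  rw [Finset.card_compl, v.2, Fintype.card_fin]; omega

theorem card_compl_insert (v : OddVertex k) {p : Fin (2 * k - 1)} (hp : p ∉ v.1) :
    ((insert p v.1)ᶜ).card = k - 1 := by
  rw [Finset.card_compl, Finset.card_insert_of_notMem hp, v.2, Fintype.card_fin]; omega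

/-- The neighbour of `v` in the odd graph that misses the point `p ∉ v`. -/
def opposite (v : OddVertex k) (p : Fin (2 * k - 1)) (hp : p ∉ v.1) : OddVertex k :=
  ⟨(insert p v.1)ᶜ, v.card_compl_insert hp⟩

theorem disjoint_opposite (v : OddVertex k) {p : Fin (2 * k - 1)} (hp : p ∉ v.1) :
    Disjoint v.1 (v.opposite p hp).1 :=
  Finset.disjoint_left.2 fun x hx h => by simp [opposite, hx] at h

theorem notMem_opposite (v : OddVertex k) {p : Fin (2 * k - 1)} (hp : p ∉ v.1) :
    p ∉ (v.opposite p hp).1 := by simp [opposite]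

theorem eq_opposite {v w : OddVertex k} {p : Fin (2 * k - 1)} (hp : p ∉ v.1)
    (h : Disjoint v.1 w.1) (hw : p ∉ w.1) : w = v.opposite p hp := by
  refine eq_of_subset fun x hx => ?_
  have := Finset.disjoint_right.1 h hx
  simp only [opposite, Finset.mem_compl, Finset.mem_insert, not_or]
  exact ⟨fun e => hw (e ▸ hx), this⟩

theorem exists_notMem_of_disjoint (hk : 1 ≤ k) {v w : OddVertex k} (h : Disjoint v.1 w.1) :
    ∃ p, p ∉ v.1 ∧ p ∉ w.1 := by
  by_contra! hc
  have h1 : (v.1 ∪ w.1) = Finset.univ := by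
    ext x
    simpa using (or_iff_not_imp_left.2 (hc x))
  have h2 := Finset.card_union_of_disjoint h
  rw [h1, v.2, w.2, Finset.card_univ, Fintype.card_fin] at h2
  omega

theorem eq_of_notMem {u v w : OddVertex k} {p : Fin (2 * k - 1)} (hp : p ∉ u.1)
    (hv : Disjoint u.1 v.1) (hpv : p ∉ v.1) (hw : Disjoint u.1 w.1) (hpw : p ∉ w.1) : v = w :=
  (eq_opposite hp hv hpv).trans (eq_opposite hp hw hpw).symm

/-- Both `w` and `u` are the neighbour of `v` missing a point of `z \ v`. This excludes four-cycles
from the odd graph. -/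
theorem eq_of_common_neighbors {u v w z : OddVertex k} (hvz : v ≠ z)
    (hvw : Disjoint v.1 w.1) (hvu : Disjoint v.1 u.1)
    (hzw : Disjoint z.1 w.1) (hzu : Disjoint z.1 u.1) : w = u := by
  have : ¬ z.1 ⊆ v.1 := fun h => hvz (eq_of_subset h).symm
  obtain ⟨p, hpz, hpv⟩ := Finset.not_subset.1 this
  exact eq_of_notMem hpv hvw (Finset.disjoint_left.1 hzw hpz) hvu
    (Finset.disjoint_left.1 hzu hpz)

/-- Three disjoint vertices need `3(k-1)` points, more than `2k-1` exactly when `k ≥ 3`. -/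
theorem not_triangle (hk : 3 ≤ k) {u v w : OddVertex k} (huv : Disjoint u.1 v.1)
    (huw : Disjoint u.1 w.1) (hvw : Disjoint v.1 w.1) : False := by
  have h1 := Finset.card_union_of_disjoint (Finset.disjoint_union_left.2 ⟨huw, hvw⟩)
  rw [Finset.card_union_of_disjoint huv, u.2, v.2, w.2] at h1
  have := Finset.card_le_univ (u.1 ∪ v.1 ∪ w.1)
  rw [Fintype.card_fin] at this
  omega

theorem ne_of_disjoint (hk : 2 ≤ k) {u v : OddVertex k} (h : Disjoint u.1 v.1) : u ≠ v := by
  rintro rfl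
  have := u.2
  rw [disjoint_self.1 h] at this
  simp at this
  omega

theorem exists_disjoint_pair (hk : 2 ≤ k) (v : OddVertex k) :
    ∃ u w : OddVertex k, u ≠ w ∧ Disjoint v.1 u.1 ∧ Disjoint v.1 w.1 := by
  have : 1 < (v.1ᶜ).card := by rw [v.card_compl (by omega)]; omega
  obtain ⟨p, hp, q, hq, hpq⟩ := Finset.one_lt_card.1 this
  rw [Finset.mem_compl] at hp hq
  refine ⟨v.opposite p hp, v.opposite q hq, fun h => ?_, v.disjoint_opposite hp,
    v.disjoint_opposite hq⟩
  have h1 : q ∈ (v.opposite p hp).1 := by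
    simp [opposite, hpq.symm, hq]
  rw [h] at h1
  exact v.notMem_opposite hq h1

/-- Two vertices of the odd graph that agree outside one exchanged point have a common
neighbour. -/
theorem exists_common_neighbor_of_exchange (v : OddVertex k) {p q : Fin (2 * k - 1)}
    (hp : p ∈ v.1) (hq : q ∉ v.1) :
    ∃ w u : OddVertex k, w.1 = insert q (v.1.erase p) ∧
      Disjoint u.1 v.1 ∧ Disjoint u.1 w.1 := by
  refine ⟨⟨insert q (v.1.erase p), ?_⟩, v.opposite q hq, rfl,
    (v.disjoint_opposite hq).symm, ?_⟩
  · have := Finset.card_pos.2 ⟨p, hp⟩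
    rw [Finset.card_insert_of_notMem (fun h => hq (Finset.mem_of_mem_erase h)),
      Finset.card_erase_of_mem hp, v.2]
    rw [v.2] at this
    omega
  · refine Finset.disjoint_left.2 fun x hx h => ?_
    simp only [opposite, Finset.mem_compl, Finset.mem_insert, not_or] at hx
    simp only [Finset.mem_insert, Finset.mem_erase] at h
    tauto

end OddVertex

/-! ### Four-cycles in the folded graph -/

open OddVertex

variable {k : ℕ}

theorem doubleOdd_adj (hk : 2 ≤ k) {x y : OddVertex k × Bool} :
    (doubleOdd k).Adj x y ↔ Disjoint x.1.1 y.1.1 ∧ x.2 ≠ y.2 :=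
  ⟨fun h => ⟨h.1.2, h.2⟩, fun h => ⟨⟨ne_of_disjoint hk h.1, h.1⟩, h.2⟩⟩

theorem foldedDoubleOdd_adj (hk : 2 ≤ k) {x y : OddVertex k × Bool} :
    (foldedDoubleOdd k).Adj x y ↔ (Disjoint x.1.1 y.1.1 ∨ x.1 = y.1) ∧ x.2 ≠ y.2 := by
  have h : (y.2 = !x.2) ↔ x.2 ≠ y.2 := by
    cases x.2 <;> cases y.2 <;> simp
  change (doubleOdd k).Adj x y ∨ (x.1 = y.1 ∧ y.2 = !x.2) ↔ _
  rw [doubleOdd_adj hk, h]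
  tauto

/-- The edge `x y` of `G` lies on two four-cycles `x y z u` with different vertices `z`. -/
def InTwoSquares {V : Type*} (G : SimpleGraph V) (x y : V) : Prop :=
  ∃ z z', z ≠ z' ∧ (z ≠ x ∧ ∃ u, u ≠ y ∧ G.Adj y z ∧ G.Adj z u ∧ G.Adj u x) ∧
    (z' ≠ x ∧ ∃ u, u ≠ y ∧ G.Adj y z' ∧ G.Adj z' u ∧ G.Adj u x)

theorem InTwoSquares.map {V : Type*} {G : SimpleGraph V} {f : Equiv.Perm V}
    (hf : f ∈ graphAut G) {x y : V} (h : InTwoSquares G x y) :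
    InTwoSquares G (f x) (f y) := by
  obtain ⟨z, z', hne, ⟨h1, u, h2, h3, h4, h5⟩, h1', u', h2', h3', h4', h5'⟩ := h
  have hf' : ∀ a b, G.Adj (f a) (f b) ↔ G.Adj a b := hf
  exact ⟨f z, f z', f.injective.ne hne,
    ⟨f.injective.ne h1, f u, f.injective.ne h2, (hf' _ _).2 h3, (hf' _ _).2 h4, (hf' _ _).2 h5⟩,
    f.injective.ne h1', f u', f.injective.ne h2', (hf' _ _).2 h3', (hf' _ _).2 h4',
    (hf' _ _).2 h5'⟩

theorem inTwoSquares_map_iff {V : Type*} {G : SimpleGraph V} {f : Equiv.Perm V}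
    (hf : f ∈ graphAut G) {x y : V} :
    InTwoSquares G (f x) (f y) ↔ InTwoSquares G x y :=
  ⟨fun h => by simpa using h.map ((graphAut G).inv_mem hf), fun h => h.map hf⟩

theorem eq_of_square (hk : 3 ≤ k) {x y z u : OddVertex k × Bool}
    (hxy : (doubleOdd k).Adj x y) (hzx : z ≠ x) (huy : u ≠ y)
    (hyz : (foldedDoubleOdd k).Adj y z) (hzu : (foldedDoubleOdd k).Adj z u)
    (hux : (foldedDoubleOdd k).Adj u x) : z = (y.1, x.2) := by
  rw [doubleOdd_adj (by omega)] at hxy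
  rw [foldedDoubleOdd_adj (by omega)] at hyz hzu hux
  obtain ⟨v, i⟩ := x
  obtain ⟨w, j⟩ := y
  obtain ⟨z, l⟩ := z
  obtain ⟨u, m⟩ := u
  simp only [ne_eq, Prod.mk.injEq] at *
  obtain ⟨hvw, hij⟩ := hxy
  obtain ⟨hwz, hjl⟩ := hyz
  obtain ⟨hzu, hlm⟩ := hzu
  obtain ⟨huv, hmi⟩ := hux
  have hli : l = i := by revert hij hjl; cases i <;> cases j <;> cases l <;> simp
  have hmj : m = j := by revert hij hmi; cases i <;> cases j <;> cases m <;> simp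
  refine ⟨?_, hli⟩
  replace hzx : z ≠ v := fun h => hzx ⟨h, hli⟩
  replace huy : u ≠ w := fun h => huy ⟨h, hmj⟩
  -- If `y z` is not an added edge, forgetting layers turns the square into a four-cycle or a
  -- triangle of `O_k`, or forces `z = x`.
  rcases hwz with hwz | rfl
  · exfalso
    rcases huv with huv | rfl
    · rcases hzu with hzu | rfl
      · exact huy (eq_of_common_neighbors hzx hzu hwz.symm huv.symm hvw)
      · exact not_triangle hk huv hwz.symm hvw
    · rcases hzu with hzu | rfl
      · exact not_triangle hk hwz hvw.symm hzu
      · exact hzx rfl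
  · rfl

theorem doubleOdd_adj_iff_not_inTwoSquares (hk : 3 ≤ k) {x y : OddVertex k × Bool} :
    (doubleOdd k).Adj x y ↔
      (foldedDoubleOdd k).Adj x y ∧ ¬ InTwoSquares (foldedDoubleOdd k) x y := by
  constructor
  · refine fun h => ⟨Or.inl h, ?_⟩
    rintro ⟨z, z', hne, ⟨h1, u, h2, h3, h4, h5⟩, h1', u', h2', h3', h4', h5'⟩
    exact hne ((eq_of_square hk h h1 h2 h3 h4 h5).trans
      (eq_of_square hk h h1' h2' h3' h4' h5').symm)
  · rintro ⟨h | ⟨h, h'⟩, hn⟩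
    · exact h
    · refine absurd ?_ hn
      obtain ⟨v, i⟩ := x
      obtain ⟨w, j⟩ := y
      obtain rfl : v = w := h
      obtain rfl : j = !i := h'
      -- The two copies of `v` and the two copies of any neighbour `w` form a square.
      have key : ∀ w : OddVertex k, Disjoint v.1 w.1 → (w, i) ≠ (v, i) ∧
          ∃ u, u ≠ (v, !i) ∧ (foldedDoubleOdd k).Adj (v, !i) (w, i) ∧
          (foldedDoubleOdd k).Adj (w, i) u ∧ (foldedDoubleOdd k).Adj u (v, i) := by
        intro w hw
        have := (ne_of_disjoint (by omega) hw).symm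
        refine ⟨by simp [this], (w, !i), by simp [this], ?_⟩
        simp only [foldedDoubleOdd_adj (show 2 ≤ k by omega)]
        simp [hw, hw.symm]
      obtain ⟨u, w, huw, hu, hw⟩ := exists_disjoint_pair (by omega) v
      exact ⟨(u, i), (w, i), by simp [huw], key u hu, key w hw⟩

theorem graphAut_folded_le (hk : 3 ≤ k) :
    graphAut (foldedDoubleOdd k) ≤ graphAut (doubleOdd k) := by
  intro f hf x y
  rw [doubleOdd_adj_iff_not_inTwoSquares hk, doubleOdd_adj_iff_not_inTwoSquares hk,
    inTwoSquares_map_iff hf, hf x y]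

theorem layerSwap_mem (hk : 2 ≤ k) : layerSwap k ∈ graphAut (foldedDoubleOdd k) := by
  intro x y
  rw [foldedDoubleOdd_adj hk, foldedDoubleOdd_adj hk]
  simp [layerSwap]

theorem pointPerm_mem (hk : 2 ≤ k) (σ : Equiv.Perm (Fin (2 * k - 1))) :
    pointPerm k σ ∈ graphAut (foldedDoubleOdd k) := by
  intro x y
  rw [foldedDoubleOdd_adj hk, foldedDoubleOdd_adj hk]
  simp [pointPerm, Subtype.ext_iff]

/-! ### Rigidity of automorphisms of the double graph -/

/-- An automorphism of `2O_k` that fixes all neighbours of both ends of an edge fixes all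
vertices within distance two of either end. -/
theorem fixes_of_fixes_edge_neighbors (hk : 2 ≤ k) {f : Equiv.Perm (OddVertex k × Bool)}
    (hf : f ∈ graphAut (doubleOdd k)) {a b c d : OddVertex k × Bool}
    (hab : (doubleOdd k).Adj a b)
    (ha : ∀ c, (doubleOdd k).Adj a c → f c = c) (hb : ∀ c, (doubleOdd k).Adj b c → f c = c)
    (hac : (doubleOdd k).Adj a c) (hcd : (doubleOdd k).Adj c d) : f d = d := by
  have hf' : ∀ a b, (doubleOdd k).Adj (f a) (f b) ↔ (doubleOdd k).Adj a b := hf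
  by_cases hda : d = a
  · exact hda ▸ hb a hab.symm
  by_cases hbc : b = c
  · subst hbc; exact hb d hcd
  have hfa := hb a hab.symm
  have hfda : f d ≠ a := fun h => hda (f.injective (h.trans hfa.symm))
  have hfcd : (doubleOdd k).Adj c (f d) := by
    have := (hf' c d).2 hcd
    rwa [ha c hac] at this
  rw [doubleOdd_adj hk] at hab hac hcd hfcd
  obtain ⟨v, i⟩ := a
  obtain ⟨w, j⟩ := b
  obtain ⟨u, l⟩ := c
  obtain ⟨t, m⟩ := d
  rcases hfd : f (t, m) with ⟨t', m'⟩
  rw [hfd] at hfda hfcd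
  simp only [ne_eq, Prod.mk.injEq] at *
  obtain rfl : j = !i := by have := hab.2; revert this; cases i <;> cases j <;> simp
  obtain rfl : l = !i := by have := hac.2; revert this; cases i <;> cases l <;> simp
  obtain rfl : m = i := by have := hcd.2; revert this; cases i <;> cases m <;> simp
  obtain rfl : m' = m := by have := hfcd.2; revert this; cases m <;> cases m' <;> simp
  refine ⟨?_, rfl⟩
  replace hda : t ≠ v := fun h => hda ⟨h, rfl⟩
  replace hbc : w ≠ u := fun h => hbc ⟨h, rfl⟩
  replace hfda : t' ≠ v := fun h => hfda ⟨h, rfl⟩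
  obtain ⟨hvw, -⟩ := hab
  obtain ⟨hvu, -⟩ := hac
  obtain ⟨hut, -⟩ := hcd
  obtain ⟨hut', -⟩ := hfcd
  -- Since `t` is the neighbour of `u` missing `y`, it suffices to show that `t'` misses `y` too.
  obtain ⟨y, hyv, hyt⟩ := Finset.not_subset.1 fun h : v.1 ⊆ t.1 => hda (eq_of_subset h).symm
  have hyw := Finset.disjoint_left.1 hvw hyv
  have hyu := Finset.disjoint_left.1 hvu hyv
  obtain ⟨q, hqu, hqw⟩ := Finset.not_subset.1 fun h : u.1 ⊆ w.1 => hbc (eq_of_subset h).symm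
  have hqv := Finset.disjoint_right.1 hvu hqu
  have hfs : f (w.opposite y hyw, m') = (w.opposite y hyw, m') :=
    hb _ ((doubleOdd_adj hk).2 ⟨w.disjoint_opposite hyw, by simp⟩)
  -- The vertex `e` closes the path `w.opposite y`, `w`, `v`, `u`, `t` to a hexagon. As `q` is the
  -- point outside `v ∪ w`, the rest of `u` lies in `w`.
  obtain ⟨e, het, hes⟩ : ∃ e : OddVertex k, Disjoint e.1 t.1 ∧
      Disjoint e.1 (w.opposite y hyw).1 := by
    refine ⟨⟨insert y (u.1.erase q), ?_⟩, ?_, ?_⟩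
    · rw [Finset.card_insert_of_notMem (fun h => hyu (Finset.mem_of_mem_erase h)),
        Finset.card_erase_of_mem hqu, u.2]
      omega
    · refine Finset.disjoint_left.2 fun x hx h => ?_
      rcases Finset.mem_insert.1 hx with rfl | hx
      · exact hyt h
      · exact Finset.disjoint_left.1 hut (Finset.mem_of_mem_erase hx) h
    · refine Finset.disjoint_left.2 fun x hx h => ?_
      rcases Finset.mem_insert.1 hx with rfl | hx
      · exact w.notMem_opposite hyw h
      · have hw : w = v.opposite q hqv := eq_opposite hqv hvw hqw
        have hxv := Finset.disjoint_right.1 hvu (Finset.mem_of_mem_erase hx)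
        have : x ∈ w.1 := by
          rw [hw]
          simp [opposite, hxv, Finset.ne_of_mem_erase hx]
        exact Finset.disjoint_left.1 (w.disjoint_opposite hyw) this h
  have h1 := (hf' (e, !m') (t, m')).2 ((doubleOdd_adj hk).2 ⟨het, by simp⟩)
  have h2 := (hf' (e, !m') (w.opposite y hyw, m')).2 ((doubleOdd_adj hk).2 ⟨hes, by simp⟩)
  rw [hfd, doubleOdd_adj hk] at h1
  rw [hfs, doubleOdd_adj hk] at h2
  -- If `y ∈ t'`, the image of `e` misses `y` and is adjacent to the fixed `w.opposite y`, so it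
  -- lies over `w`. Then `w` and `u` have the common neighbours `v` and `t'`, forcing `t' = v`.
  by_cases hyt' : y ∈ t'.1
  · exfalso
    have hew : (f (e, !m')).1 = w :=
      eq_of_notMem (w.notMem_opposite hyw) h2.1.symm (Finset.disjoint_right.1 h1.1 hyt')
        (w.disjoint_opposite hyw).symm hyw
    have h3 := h1.1
    rw [hew] at h3
    exact hfda (eq_of_common_neighbors hbc h3 hvw.symm hut' hvu.symm)
  · exact eq_of_notMem hyu hut' hyt' hut hyt

/-- Exchanging one point is a walk of length two, so induction on `|w \ v|` covers the layer of `v`;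
one more edge reaches the other layer. -/
theorem doubleOdd_connected_from (hk : 2 ≤ k) {S : OddVertex k × Bool → Prop}
    {v : OddVertex k} {i : Bool} (h0 : S (v, i))
    (hS : ∀ x y, S x → (doubleOdd k).Adj x y → S y) (x : OddVertex k × Bool) : S x := by
  have key : ∀ n (w : OddVertex k), (w.1 \ v.1).card = n → S (w, i) := by
    intro n
    induction n with
    | zero =>
      intro w hw
      rw [Finset.card_eq_zero, Finset.sdiff_eq_empty_iff_subset] at hw
      rwa [eq_of_subset hw]
    | succ n ih =>
      intro w hw
      obtain ⟨p, hp⟩ := Finset.card_pos.1 (show 0 < (w.1 \ v.1).card by omega)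
      rw [Finset.mem_sdiff] at hp
      obtain ⟨q, hqv, hqw⟩ := Finset.not_subset.1 fun h : v.1 ⊆ w.1 =>
        hp.2 (by rw [eq_of_subset h]; exact hp.1)
      obtain ⟨w', u, hw', huw, huw'⟩ := w.exists_common_neighbor_of_exchange hp.1 hqw
      have h1 : w'.1 \ v.1 = (w.1 \ v.1).erase p := by
        ext x
        simp only [hw', Finset.mem_sdiff, Finset.mem_insert, Finset.mem_erase]
        constructor
        · rintro ⟨rfl | h, h'⟩
          · exact absurd hqv h'
          · tauto
        · tauto
      have h2 : S (w', i) := ih w' (by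
        rw [h1, Finset.card_erase_of_mem (Finset.mem_sdiff.2 hp), hw]; rfl)
      exact hS (u, !i) _ (hS _ _ h2 ((doubleOdd_adj hk).2 ⟨huw'.symm, by simp⟩))
        ((doubleOdd_adj hk).2 ⟨huw, by simp⟩)
  obtain ⟨w, j⟩ := x
  by_cases hj : j = i
  · subst hj; exact key _ w rfl
  · obtain ⟨u, -, -, hu, -⟩ := exists_disjoint_pair hk w
    exact hS (u, i) _ (key _ u rfl) ((doubleOdd_adj hk).2 ⟨hu.symm, fun h => hj h.symm⟩)

theorem eq_one_of_fixes_edge_neighbors (hk : 2 ≤ k) {f : Equiv.Perm (OddVertex k × Bool)}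
    (hf : f ∈ graphAut (doubleOdd k)) {a b : OddVertex k × Bool}
    (hab : (doubleOdd k).Adj a b)
    (ha : ∀ c, (doubleOdd k).Adj a c → f c = c)
    (hb : ∀ c, (doubleOdd k).Adj b c → f c = c) : f = 1 := by
  have key := doubleOdd_connected_from hk (v := a.1) (i := a.2)
    (S := fun x => (∀ c, (doubleOdd k).Adj x c → f c = c) ∧
      ∃ y, (doubleOdd k).Adj x y ∧ ∀ c, (doubleOdd k).Adj y c → f c = c)
    ⟨ha, b, hab, hb⟩ (by
      -- The invariant carries a second vertex, so that an edge with both neighbourhoods fixed is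
      -- always at hand.
      rintro x y ⟨hx, z, hxz, hz⟩ hxy
      exact ⟨fun d hd => fixes_of_fixes_edge_neighbors hk hf hxz hx hz hxy hd, x, hxy.symm, hx⟩)
  ext1 x
  obtain ⟨-, y, hxy, hy⟩ := key x
  exact hy x hxy.symm

/-! ### Recovering the permutation of the ground set -/

/-- An automorphism of `2O_k` agrees with some `pointPerm` near a vertex whose layer it
keeps. -/
theorem exists_pointPerm_eq_near (hk : 2 ≤ k) {f : Equiv.Perm (OddVertex k × Bool)}
    (hf : f ∈ graphAut (doubleOdd k)) {v w v' w' : OddVertex k} {i : Bool}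
    (hvw : Disjoint v.1 w.1) (hv : f (v, i) = (v', i)) (hw : f (w, !i) = (w', !i)) :
    ∃ σ : Equiv.Perm (Fin (2 * k - 1)),
      (∀ c, (doubleOdd k).Adj (v, i) c → f c = pointPerm k σ c) ∧
      (∀ c, (doubleOdd k).Adj (w, !i) c → f c = pointPerm k σ c) := by
  have hf' : ∀ a b, (doubleOdd k).Adj (f a) (f b) ↔ (doubleOdd k).Adj a b := hf
  have hvw' : Disjoint v'.1 w'.1 := by
    have := (hf' (v, i) (w, !i)).2 ((doubleOdd_adj hk).2 ⟨hvw, by simp⟩)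
    rw [hv, hw, doubleOdd_adj hk] at this
    exact this.1
  -- the layer and disjointness of images of neighbours
  have nbr : ∀ (x x' : OddVertex k) (j : Bool), f (x, j) = (x', j) → ∀ c : OddVertex k,
      Disjoint x.1 c.1 → ∃ c' : OddVertex k, f (c, !j) = (c', !j) ∧ Disjoint x'.1 c'.1 := by
    intro x x' j hx c hc
    have := (hf' (x, j) (c, !j)).2 ((doubleOdd_adj hk).2 ⟨hc, by simp⟩)
    rw [hx, doubleOdd_adj hk] at this
    refine ⟨(f (c, !j)).1, ?_, this.1⟩
    refine Prod.ext rfl ?_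
    have h := this.2
    revert h
    cases j <;> cases (f (c, _)).2 <;> simp
  have label : ∀ (x x' : OddVertex k) (j : Bool), f (x, j) = (x', j) → ∀ p (hp : p ∉ x.1),
      ∃ q, ∃ hq : q ∉ x'.1, f (x.opposite p hp, !j) = (x'.opposite q hq, !j) := by
    intro x x' j hx p hp
    obtain ⟨c', hc, hd⟩ := nbr x x' j hx _ (x.disjoint_opposite hp)
    obtain ⟨q, hq, hq'⟩ := exists_notMem_of_disjoint (by omega) hd
    exact ⟨q, hq, by rw [hc, eq_opposite hq hd hq']⟩
  have hmem : ∀ p, p ∈ v.1 → p ∉ w.1 := fun p hp => Finset.disjoint_left.1 hvw hp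
  -- Points outside `v` label the neighbours of `v`; points of `v` label the neighbours of `w` other
  -- than `v`. Each ground point is thus used once.
  have hs : ∀ p, ∃ q, (∀ hp : p ∉ v.1, ∃ hq : q ∉ v'.1,
        f (v.opposite p hp, !i) = (v'.opposite q hq, !i)) ∧
      (∀ hp : p ∈ v.1, ∃ hq : q ∉ w'.1,
        f (w.opposite p (hmem p hp), i) = (w'.opposite q hq, i)) := by
    intro p
    by_cases hp : p ∈ v.1
    · obtain ⟨q, hq, h⟩ := label w w' (!i) hw p (hmem p hp)
      rw [Bool.not_not] at h
      exact ⟨q, fun h => absurd hp h, fun _ => ⟨hq, h⟩⟩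
    · obtain ⟨q, hq, h⟩ := label v v' i hv p hp
      exact ⟨q, fun _ => ⟨hq, h⟩, fun h => absurd h hp⟩
  choose s hs1 hs2 using hs
  -- Otherwise the image of `w.opposite p` would be `v'`, the image of `v`, although `p` lies in
  -- `v`.
  have hsv : ∀ p ∈ v.1, s p ∈ v'.1 := by
    intro p hp
    by_contra hc
    obtain ⟨hq, h⟩ := hs2 p hp
    rw [← eq_opposite hq hvw'.symm hc, ← hv] at h
    have h' := congrArg Prod.fst (f.injective h)
    have h'' : w.opposite p (hmem p hp) = v := h'
    exact w.notMem_opposite (hmem p hp) (h'' ▸ hp)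
  have opp_inj : ∀ (x : OddVertex k) p q (hp : p ∉ x.1) (hq : q ∉ x.1),
      x.opposite p hp = x.opposite q hq → p = q := by
    intro x p q hp hq h
    by_contra hne
    have : p ∈ (x.opposite q hq).1 := by simp [opposite, hp, hne]
    rw [← h] at this
    exact x.notMem_opposite hp this
  have hinj : Function.Injective s := by
    intro p q hpq
    by_cases hp : p ∈ v.1 <;> by_cases hq : q ∈ v.1
    · obtain ⟨h1, h1'⟩ := hs2 p hp
      obtain ⟨h2, h2'⟩ := hs2 q hq
      simp only [hpq] at h1'
      exact opp_inj w p q (hmem p hp) (hmem q hq) (congrArg Prod.fst (f.injective (h1'.trans h2'.symm)))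
    · exact absurd (hpq ▸ hsv p hp) (hs1 q hq).1
    · exact absurd (hpq ▸ hsv q hq) (hs1 p hp).1
    · obtain ⟨h1, h1'⟩ := hs1 p hp
      obtain ⟨h2, h2'⟩ := hs1 q hq
      simp only [hpq] at h1'
      exact opp_inj v p q hp hq (congrArg Prod.fst (f.injective (h1'.trans h2'.symm)))
  let σ : Equiv.Perm (Fin (2 * k - 1)) :=
    Equiv.ofBijective s (Finite.injective_iff_bijective.1 hinj)
  have hpt : ∀ (c c' : OddVertex k) (j : Bool), (∀ x ∈ c.1, s x ∈ c'.1) →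
      pointPerm k σ (c, j) = (c', j) := by
    intro c c' j h
    refine Prod.ext (eq_of_subset fun y hy => ?_) rfl
    obtain ⟨x, hx, rfl⟩ := Finset.mem_map.1 hy
    exact h x hx
  have hsv' : ∀ p, p ∉ v.1 → s p ∉ v'.1 := fun p hp => (hs1 p hp).1
  refine ⟨σ, ?_, ?_⟩
  · rintro ⟨c, j⟩ hc
    rw [doubleOdd_adj hk] at hc
    dsimp only at hc
    obtain rfl : j = !i := by have := hc.2; revert this; cases i <;> cases j <;> simp
    obtain ⟨p, hp, hpc⟩ := exists_notMem_of_disjoint (by omega) hc.1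
    obtain ⟨hq, h⟩ := hs1 p hp
    rw [eq_opposite hp hc.1 hpc, h]
    refine (hpt _ _ _ fun x hx => ?_).symm
    simp only [opposite, Finset.mem_compl, Finset.mem_insert, not_or] at hx ⊢
    exact ⟨hinj.ne hx.1, hsv' x hx.2⟩
  · have hsw : ∀ x, x ∉ w.1 → s x ∉ w'.1 := by
      intro x hx
      by_cases hxv : x ∈ v.1
      · exact (hs2 x hxv).1
      -- Here `w` is itself the neighbour of `v` labelled `x`, so `s x` is the label of `w'`.
      · obtain ⟨hq, h⟩ := hs1 x hxv
        rw [← eq_opposite hxv hvw hx, hw, Prod.mk.injEq] at h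
        rw [h.1]
        exact v'.notMem_opposite hq
    rintro ⟨c, j⟩ hc
    rw [doubleOdd_adj hk] at hc
    dsimp only at hc
    obtain rfl : j = i := by have := hc.2; revert this; cases i <;> cases j <;> simp
    obtain ⟨p, hp, hpc⟩ := exists_notMem_of_disjoint (by omega) hc.1
    by_cases hpv : p ∈ v.1
    · obtain ⟨hq, h⟩ := hs2 p hpv
      rw [eq_opposite hp hc.1 hpc, h]
      refine (hpt _ _ _ fun x hx => ?_).symm
      simp only [opposite, Finset.mem_compl, Finset.mem_insert, not_or] at hx ⊢
      exact ⟨hinj.ne hx.1, hsw x hx.2⟩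
    · obtain rfl : c = v := eq_of_notMem hp hc.1 hpc hvw.symm hpv
      rw [hv]
      exact (hpt _ _ _ hsv).symm

theorem exists_eq_pointPerm (hk : 3 ≤ k) {f : Equiv.Perm (OddVertex k × Bool)}
    (hf : f ∈ graphAut (doubleOdd k)) {v : OddVertex k} {i : Bool} (hv : (f (v, i)).2 = i) :
    ∃ σ, f = pointPerm k σ := by
  have hk2 : 2 ≤ k := by omega
  have hf' : ∀ a b, (doubleOdd k).Adj (f a) (f b) ↔ (doubleOdd k).Adj a b := hf
  obtain ⟨w, -, -, hw, -⟩ := exists_disjoint_pair hk2 v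
  have hadj : (doubleOdd k).Adj (v, i) (w, !i) := (doubleOdd_adj hk2).2 ⟨hw, by simp⟩
  have h2 : (f (w, !i)).2 = !i := by
    have := ((doubleOdd_adj hk2).1 ((hf' _ _).2 hadj)).2
    rw [hv] at this
    revert this
    cases i <;> cases (f (w, _)).2 <;> simp
  obtain ⟨σ, h3, h4⟩ := exists_pointPerm_eq_near hk2 hf hw
    (v' := (f (v, i)).1) (w' := (f (w, !i)).1) (Prod.ext rfl hv) (Prod.ext rfl h2)
  have hσ := graphAut_folded_le hk (pointPerm_mem hk2 σ)
  have h5 : (pointPerm k σ)⁻¹ * f = 1 :=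
    eq_one_of_fixes_edge_neighbors hk2 (Subgroup.mul_mem _ (Subgroup.inv_mem _ hσ) hf) hadj
      (fun c hc => by rw [Equiv.Perm.mul_apply, h3 c hc]; exact Equiv.symm_apply_apply _ c)
      (fun c hc => by rw [Equiv.Perm.mul_apply, h4 c hc]; exact Equiv.symm_apply_apply _ c)
  exact ⟨σ, (inv_mul_eq_one.1 h5).symm⟩

/-! ### The group structure -/

theorem OddVertex.exists_mem_notMem (hk : 2 ≤ k) {p q : Fin (2 * k - 1)} (h : p ≠ q) :
    ∃ v : OddVertex k, p ∈ v.1 ∧ q ∉ v.1 := by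
  obtain ⟨s, hs1, hs2, hs3⟩ := Finset.exists_subsuperset_card_eq (s := {p})
    (t := Finset.univ.erase q) (n := k - 1) (by simpa using h) (by simp; omega)
    (by simp [Finset.card_erase_of_mem]; omega)
  exact ⟨⟨s, hs3⟩, hs1 (by simp), fun hq => by simpa using hs2 hq⟩

/-- If `σ p ≠ τ p`, a vertex containing `p` but not `σ⁻¹ (τ p)` has different images. -/
theorem pointPerm_injective (hk : 2 ≤ k) : Function.Injective (pointPerm k) := by
  intro σ τ h
  ext1 p
  by_contra hne
  have hne' : p ≠ σ⁻¹ (τ p) := fun e => hne (by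
    exact (congrArg σ e).trans (Equiv.apply_symm_apply σ _))
  obtain ⟨v, hp, hq⟩ := exists_mem_notMem hk hne'
  have h1 : (pointPerm k σ (v, true)).1.1 = (pointPerm k τ (v, true)).1.1 := by rw [h]
  have h2 : τ p ∈ (pointPerm k τ (v, true)).1.1 := by simp [pointPerm, hp]
  rw [← h1] at h2
  obtain ⟨x, hx, hx'⟩ := Finset.mem_map.1 h2
  refine hq ?_
  rw [← hx']
  simpa using hx

theorem pointPerm_mul (σ τ : Equiv.Perm (Fin (2 * k - 1))) :
    pointPerm k (σ * τ) = pointPerm k σ * pointPerm k τ := by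
  ext1 x
  exact Prod.ext (Subtype.ext (Finset.map_map τ.toEmbedding σ.toEmbedding x.1.1).symm) rfl

theorem pointPerm_one : pointPerm k 1 = 1 := by
  ext1 x
  exact Prod.ext (Subtype.ext Finset.map_refl) rfl

theorem layerSwap_mul_self : layerSwap k * layerSwap k = 1 := by
  ext x <;> simp [layerSwap]

theorem layerSwap_mul_pointPerm (σ : Equiv.Perm (Fin (2 * k - 1))) :
    layerSwap k * pointPerm k σ = pointPerm k σ * layerSwap k := by
  ext x <;> simp [layerSwap, pointPerm]

theorem exists_eq_layerSwap_pow_mul_pointPerm (hk : 3 ≤ k)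
    {f : Equiv.Perm (OddVertex k × Bool)} (hf : f ∈ graphAut (doubleOdd k)) :
    ∃ (i : ZMod 2) (σ : Equiv.Perm (Fin (2 * k - 1))),
      f = layerSwap k ^ i.val * pointPerm k σ := by
  obtain ⟨s, -, hs⟩ := Finset.exists_subset_card_eq
    (s := (Finset.univ : Finset (Fin (2 * k - 1)))) (n := k - 1) (by simp; omega)
  let v : OddVertex k := ⟨s, hs⟩
  by_cases h : (f (v, true)).2 = true
  · obtain ⟨σ, hσ⟩ := exists_eq_pointPerm hk hf h
    exact ⟨0, σ, by simp [hσ]⟩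
  · have hθ := graphAut_folded_le hk (layerSwap_mem (k := k) (by omega))
    have h' : ((layerSwap k * f) (v, true)).2 = true := by simpa [layerSwap] using h
    obtain ⟨σ, hσ⟩ := exists_eq_pointPerm hk (Subgroup.mul_mem _ hθ hf) h'
    refine ⟨1, σ, ?_⟩
    rw [← hσ, ZMod.val_one, pow_one, ← mul_assoc, layerSwap_mul_self, one_mul]

theorem layerSwap_pow_val_add (i j : ZMod 2) :
    layerSwap k ^ (i + j).val = layerSwap k ^ i.val * layerSwap k ^ j.val := by
  rw [← pow_add, ZMod.val_add]
  exact (pow_eq_pow_mod _ (by rw [pow_two, layerSwap_mul_self])).symm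

/-- The action of `ℤ₂ × Sym(2k-1)` on the folded graph. -/
def swapPointHom (k : ℕ) (hk : 2 ≤ k) :
    Multiplicative (ZMod 2) × Equiv.Perm (Fin (2 * k - 1)) →* graphAut (foldedDoubleOdd k) where
  toFun x := ⟨layerSwap k ^ x.1.toAdd.val * pointPerm k x.2,
    Subgroup.mul_mem _ (Subgroup.pow_mem _ (layerSwap_mem hk) _) (pointPerm_mem hk _)⟩
  map_one' := Subtype.ext (by simp [pointPerm_one])
  map_mul' x y := Subtype.ext (by
    have hc : Commute (layerSwap k ^ y.1.toAdd.val) (pointPerm k x.2) :=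
      Commute.pow_left (layerSwap_mul_pointPerm x.2) _
    simp only [Prod.fst_mul, Prod.snd_mul, toAdd_mul, Subgroup.coe_mul, layerSwap_pow_val_add,
      pointPerm_mul, mul_assoc]
    rw [← mul_assoc (layerSwap k ^ y.1.toAdd.val), hc.eq, mul_assoc])

theorem swapPointHom_injective (hk : 2 ≤ k) : Function.Injective (swapPointHom k hk) := by
  rw [injective_iff_map_eq_one]
  rintro ⟨i, σ⟩ h
  have h1 : layerSwap k ^ i.toAdd.val * pointPerm k σ = 1 := congrArg Subtype.val h
  have hi : i.toAdd.val = 0 ∨ i.toAdd.val = 1 := by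
    have := ZMod.val_lt i.toAdd
    omega
  rcases hi with hi | hi <;> rw [hi] at h1
  · rw [pow_zero, one_mul, ← pointPerm_one] at h1
    rw [pointPerm_injective hk h1]
    exact Prod.ext (toAdd_eq_zero.1 ((ZMod.val_eq_zero _).1 hi)) rfl
  -- With exponent one the product changes the layer of every vertex, so it is not the identity.
  · exfalso
    obtain ⟨v, -, -⟩ := exists_mem_notMem hk
      (show (⟨0, by omega⟩ : Fin (2 * k - 1)) ≠ ⟨1, by omega⟩ by simp)
    have := congrArg Prod.snd (Equiv.congr_fun h1 (v, true))
    simp [layerSwap, pointPerm] at this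

theorem theorem6 (k : ℕ) (hk : 3 ≤ k) :
    graphAut (foldedDoubleOdd k) = graphAut (doubleOdd k) ∧
    ∃ φ : Multiplicative (ZMod 2) × Equiv.Perm (Fin (2 * k - 1)) ≃*
        graphAut (foldedDoubleOdd k),
      (φ (Multiplicative.ofAdd 1, 1) : Equiv.Perm (OddVertex k × Bool)) = layerSwap k ∧
      ∀ σ : Equiv.Perm (Fin (2 * k - 1)),
        (φ (1, σ) : Equiv.Perm (OddVertex k × Bool)) = pointPerm k σ := by
  have hk2 : 2 ≤ k := by omega
  refine ⟨le_antisymm (graphAut_folded_le hk) fun f hf => ?_,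
    MulEquiv.ofBijective (swapPointHom k hk2) ⟨swapPointHom_injective hk2, ?_⟩, ?_, fun σ => ?_⟩
  · obtain ⟨i, σ, rfl⟩ := exists_eq_layerSwap_pow_mul_pointPerm hk hf
    exact Subgroup.mul_mem _ (Subgroup.pow_mem _ (layerSwap_mem hk2) _) (pointPerm_mem hk2 _)
  · rintro ⟨f, hf⟩
    obtain ⟨i, σ, rfl⟩ :=
      exists_eq_layerSwap_pow_mul_pointPerm hk (graphAut_folded_le hk hf)
    exact ⟨(Multiplicative.ofAdd i, σ), rfl⟩
  · change layerSwap k ^ (1 : ZMod 2).val * pointPerm k 1 = _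
    rw [ZMod.val_one, pow_one, pointPerm_one, mul_one]
  · change layerSwap k ^ (0 : ZMod 2).val * pointPerm k σ = _
    rw [ZMod.val_zero, pow_zero, one_mul]
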